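/- Let $n\ge 1$, let $\Omega=\prod_{i=1}^n(\underline x_i,\overline x_i)\subset\mathbb{R}^n$ be a bounded open rectangular domain with $\underline x_i<\overline x_i$, let $\alpha\in(0,1)$, $f\in L^2(\Omega)$ and let $g$ be a function on $\partial\Omega$. Let $\hat H_1(\Omega)$ be the space of all $u\in L^2(\Omega)$ whose weak partial derivatives $\partial_{x_i}u$, $1\le i\le n$, belong to $L^2(\Omega)$, and let $H^1_0(\Omega)$ be the subspace of functions with vanishing trace on $\partial\Omega$. Consider the Dirichlet problem $$-\sum_{i=1}^n\partial_{x_i}\Big(J^\alpha_{\underline x_i}\partial_{x_i}u+J^\alpha_{\overline x_i-}\partial_{x_i}u\Big)=f\ \text{ in }\Omega,\qquad u=g\ \text{ on }\partial\Omega,$$ where $J^\alpha_{\underline x_i}$ and $J^\alpha_{\overline x_i-}$ are the left and right Riemann-Liouville fractional integrals in the $i$-th variable, $$J^\alpha_{\underline x_i}h(x)=\frac1{\Gamma(\alpha)}\int_{\underline x_i}^{x_i}(x_i-w)^{\alpha-1}h(x_1,\dots,x_{i-1},w,x_{i+1},\dots,x_n)\,dw,$$ $$J^\alpha_{\overline x_i-}h(x)=\frac1{\Gamma(\alpha)}\int_{x_i}^{\overline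 x_i}(w-x_i)^{\alpha-1}h(x_1,\dots,x_{i-1},w,x_{i+1},\dots,x_n)\,dw.$$ For $u\in\hat H_1(\Omega)$ and $v\in H^1_0(\Omega)$ put $$\langle\mathcal L[u],v\rangle=\sum_{i=1}^n\int_\Omega\big(J^\alpha_{\underline x_i}\partial_{x_i}u\big)\,\partial_{x_i}v\,dx+\sum_{i=1}^n\int_\Omega\big(J^\alpha_{\overline x_i-}\partial_{x_i}u\big)\,\partial_{x_i}v\,dx-\int_\Omega fv\,dx,$$ $$\|\mathcal L[u]\|_{op}=\sup_{v\in H^1_0(\Omega),\,v\ne0}\frac{|\langle\mathcal L[u],v\rangle|}{\|v\|_{L^2(\Omega)}}\in[0,\infty].$$ A weak solution is a function $u\in\hat H_1(\Omega)$ with $u=g$ on $\partial\Omega$ in the sense of traces in $L^2(\partial\Omega)$ and with $\langle\mathcal L[u],v\rangle=0$ for all $v\in H^1_0(\Omega)$. Let $u\in\hat H_1(\Omega)$ satisfy $u=g$ on $\partial\Omega$ in the sense of traces. Then $u$ is the unique weak solution in $\hat H_1(\Omega)$ (that is, $u$ is a weak solution and every weak solution equals $u$ almost everywhere in $\Omega$)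 if and only if $\|\mathcal L[u]\|_{op}=0$. -/

import Mathlib

open MeasureTheory Set Filter Topology
open scoped ENNReal ContDiff

noncomputable section

namespace FracDirichlet

/-- The open rectangular domain `Ω = ∏ i, (a i, b i)`. -/
def box {n : ℕ} (a b : Fin n → ℝ) : Set (Fin n → ℝ) :=
  Set.univ.pi fun i => Ioo (a i) (b i)

/-- Lebesgue measure on `Ω`. -/
def vol {n : ℕ} (a b : Fin n → ℝ) : Measure (Fin n → ℝ) :=
  volume.restrict (box a b)

/-- The classical partial derivative `∂φ/∂xᵢ`. -/
def pderiv {n : ℕ} (i : Fin n) (φ : (Fin n → ℝ) → ℝ) (x : Fin n → ℝ) : ℝ :=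
  fderiv ℝ φ x (Pi.single i 1)

/-- `d` is an `L²(Ω)` function which is the weak partial derivative `∂u/∂xᵢ` in `Ω`. -/
def IsWeakPartial {n : ℕ} (a b : Fin n → ℝ) (i : Fin n) (u d : (Fin n → ℝ) → ℝ) : Prop :=
  MemLp d 2 (vol a b) ∧
    ∀ φ : (Fin n → ℝ) → ℝ, ContDiff ℝ ∞ φ → HasCompactSupport φ → tsupport φ ⊆ box a b →
      ∫ x, u x * pderiv i φ x ∂(vol a b) = - ∫ x, d x * φ x ∂(vol a b)

/-- The space of functions in `L²(Ω)` all of whose first order weak partial derivatives exist and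
are in `L²(Ω)`. -/
def MemH1 {n : ℕ} (a b : Fin n → ℝ) (u : (Fin n → ℝ) → ℝ) : Prop :=
  MemLp u 2 (vol a b) ∧ ∀ i, ∃ d, IsWeakPartial a b i u d

open Classical in
/-- The weak partial derivative `∂u/∂xᵢ` in `L²(Ω)`, unique up to a null set of `Ω` when it exists
(and zero when there is none). -/
def weakPartial {n : ℕ} (a b : Fin n → ℝ) (i : Fin n) (u : (Fin n → ℝ) → ℝ) :
    (Fin n → ℝ) → ℝ :=
  if h : ∃ d, IsWeakPartial a b i u d then h.choose else 0

/-- Lebesgue measure on a face of `Ω` orthogonal to the `i`-th axis, in the remaining `d`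
coordinates. -/
def faceVol {d : ℕ} (a b : Fin (d + 1) → ℝ) (i : Fin (d + 1)) : Measure (Fin d → ℝ) :=
  vol (fun j => a (i.succAbove j)) (fun j => b (i.succAbove j))

/-- The boundary values of `h` on the face of `Ω` on which the `i`-th coordinate is `c`. -/
def onFace {d : ℕ} (i : Fin (d + 1)) (c : ℝ) (h : (Fin (d + 1) → ℝ) → ℝ) : (Fin d → ℝ) → ℝ :=
  fun y => h (i.insertNth c y)

/-- `u ∈ H¹(Ω)` has trace `g ∈ L²(∂Ω)`, that is, `u = g` on `∂Ω`. The trace is the continuous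
extension to `H¹(Ω)` of the restriction to `∂Ω` of functions that are smooth up to the boundary:
`u` is the limit in `H¹(Ω)` of such functions `φ k`, whose restrictions to `∂Ω` converge to `g`
in `L²(∂Ω)`, i.e. in `L²` of each of the `2 (d + 1)` faces. -/
def HasTrace {d : ℕ} (a b : Fin (d + 1) → ℝ) (u g : (Fin (d + 1) → ℝ) → ℝ) : Prop :=
  MemH1 a b u ∧
  (∀ i, ∀ c ∈ ({a i, b i} : Set ℝ), MemLp (onFace i c g) 2 (faceVol a b i)) ∧
  ∃ φ : ℕ → (Fin (d + 1) → ℝ) → ℝ,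
    (∀ k, ContDiff ℝ ∞ (φ k)) ∧
    Tendsto (fun k => eLpNorm (φ k - u) 2 (vol a b)) atTop (𝓝 0) ∧
    (∀ i, Tendsto (fun k => eLpNorm (pderiv i (φ k) - weakPartial a b i u) 2 (vol a b))
      atTop (𝓝 0)) ∧
    ∀ i, ∀ c ∈ ({a i, b i} : Set ℝ),
      Tendsto (fun k => eLpNorm (onFace i c (φ k) - onFace i c g) 2 (faceVol a b i)) atTop (𝓝 0)

/-- `H¹₀(Ω)`: the functions in `H¹(Ω)` with vanishing trace on `∂Ω`. -/
def MemH10 {d : ℕ} (a b : Fin (d + 1) → ℝ) (v : (Fin (d + 1) → ℝ) → ℝ) : Prop :=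
  MemH1 a b v ∧ HasTrace a b v 0

/-- The left Riemann-Liouville fractional integral of order `α` with base point `l`. -/
def leftRL (α l : ℝ) (h : ℝ → ℝ) (t : ℝ) : ℝ :=
  1 / Real.Gamma α * ∫ w in l..t, (t - w) ^ (α - 1) * h w

/-- The right Riemann-Liouville fractional integral of order `α` with base point `r`. -/
def rightRL (α r : ℝ) (h : ℝ → ℝ) (t : ℝ) : ℝ :=
  1 / Real.Gamma α * ∫ w in t..r, (w - t) ^ (α - 1) * h w

/-- The restriction of `h` to the line through `x` parallel to the `i`-th axis, as a function of
the `i`-th coordinate. -/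
def alongLine {n : ℕ} (i : Fin n) (h : (Fin n → ℝ) → ℝ) (x : Fin n → ℝ) : ℝ → ℝ :=
  fun w => h (Function.update x i w)

/-- The weak form `⟨𝓛[u], v⟩` of the fractional equation with right-hand side `f`. -/
def pairing {n : ℕ} (a b : Fin n → ℝ) (α : ℝ) (f u v : (Fin n → ℝ) → ℝ) : ℝ :=
  (∑ i, ∫ x, leftRL α (a i) (alongLine i (weakPartial a b i u) x) (x i)
      * weakPartial a b i v x ∂(vol a b))
  + (∑ i, ∫ x, rightRL α (b i) (alongLine i (weakPartial a b i u) x) (x i)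
      * weakPartial a b i v x ∂(vol a b))
  - ∫ x, f x * v x ∂(vol a b)

/-- `u ∈ H¹(Ω)` is a weak solution of the Dirichlet problem with right-hand side `f` and boundary
values `g`. -/
def IsWeakSolution {d : ℕ} (a b : Fin (d + 1) → ℝ) (α : ℝ) (f g u : (Fin (d + 1) → ℝ) → ℝ) :
    Prop :=
  MemH1 a b u ∧ HasTrace a b u g ∧ ∀ v, MemH10 a b v → pairing a b α f u v = 0

/-- The operator norm `sup |⟨𝓛[u], v⟩| / ‖v‖₂` over the nonzero `v ∈ H¹₀(Ω)`, in `[0, ∞]`. -/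
def opNorm {d : ℕ} (a b : Fin (d + 1) → ℝ) (α : ℝ) (f u : (Fin (d + 1) → ℝ) → ℝ) : ℝ≥0∞ :=
  ⨆ (v : (Fin (d + 1) → ℝ) → ℝ) (_ : MemH10 a b v) (_ : ¬ v =ᵐ[vol a b] 0),
    ENNReal.ofReal |pairing a b α f u v| / eLpNorm v 2 (vol a b)

end FracDirichlet

end

/-! The condition that the operator norm is zero just says that the pairing vanishes on all of
`MemH10` (`opNorm_eq_zero_iff`), so the content is uniqueness, and this is an energy argument. For
two weak solutions with difference `e = w - u`, subtracting the equations tested with `e` leaves `∑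
i, B i (∂ᵢe, ∂ᵢe) = 0`. Here `B i` is the form of the Riesz kernel `|t - w| ^ (α - 1)` in the `i`-th
variable, because the left and right fractional integrals add up to convolution with that kernel
(`integral_RL_add`).

The kernel is positive definite. With `s = 1 - α`, the Gamma integral writes `r ^ (-s)` as a
superposition of `exp (-(l * r))`, and `exp (-(l * |x - y|))` is up to a factor the autocorrelation
of a one-sided exponential. The form is thus an integral of squares (`riesz_quadratic_pos`), and if
it vanishes, so do the tail integrals of `exp (-(l * x)) * h x`, hence `h`.

So every term of the sum is zero and `∂ᵢe = 0`. A Poincaré inequality along smooth approximants and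
the zero trace give `e = 0` (`ae_eq_zero_of_weakPartial_ae_eq_zero`). -/

namespace FracDirichlet

/-! ### Kernels that are superpositions of products -/

section FactoredKernel

variable {P X : Type*} [MeasurableSpace P] [MeasurableSpace X] {μ : Measure P} {ν : Measure X}
  [SFinite μ] [SFinite ν]

/-- The quadratic form of a kernel `K x y = ∫ p, k p x * k p y` is an integral of squares. -/
theorem integral_factored_kernel {k : P → X → ℝ} (hk : Measurable (Function.uncurry k))
    (hk0 : ∀ p x, 0 ≤ k p x) {K : X → X → ℝ}
    (hK : ∀ᵐ q ∂ν.prod ν, Integrable (fun p => k p q.1 * k p q.2) μ ∧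
      ∫ p, k p q.1 * k p q.2 ∂μ = K q.1 q.2)
    {h : X → ℝ} (hh : AEStronglyMeasurable h ν)
    (hint : Integrable (fun q : X × X => K q.1 q.2 * (h q.2 * h q.1)) (ν.prod ν)) :
    Integrable (fun p => (∫ x, k p x * h x ∂ν) ^ 2) μ ∧
      ∫ q : X × X, K q.1 q.2 * (h q.2 * h q.1) ∂ν.prod ν
        = ∫ p, (∫ x, k p x * h x ∂ν) ^ 2 ∂μ := by
  set F : P × (X × X) → ℝ := fun z => (k z.1 z.2.1 * k z.1 z.2.2) * (h z.2.2 * h z.2.1) with hF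
  have hFm : AEStronglyMeasurable F (μ.prod (ν.prod ν)) := by
    have h1 : AEStronglyMeasurable (fun q : X × X => h q.2 * h q.1) (ν.prod ν) :=
      hh.comp_snd.mul hh.comp_fst
    refine AEStronglyMeasurable.mul ?_ h1.comp_snd
    refine Measurable.aestronglyMeasurable (Measurable.mul ?_ ?_)
    · exact hk.comp (measurable_fst.prodMk (measurable_fst.comp measurable_snd))
    · exact hk.comp (measurable_fst.prodMk (measurable_snd.comp measurable_snd))
  -- Tonelli: as `k ≥ 0`, integrating `‖F‖` over `p` gives exactly `‖K * (h * h)‖`, which is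
  -- integrable by `hint`.
  have hFi : Integrable F (μ.prod (ν.prod ν)) := by
    rw [integrable_prod_iff' hFm]
    refine ⟨?_, hint.norm.congr ?_⟩
    · filter_upwards [hK] with q hq
      exact hq.1.mul_const (h q.2 * h q.1)
    · filter_upwards [hK] with q hq
      have : ∀ p, ‖F (p, q)‖ = (k p q.1 * k p q.2) * ‖h q.2 * h q.1‖ := fun p => by
        rw [hF]
        simp only [norm_mul, Real.norm_of_nonneg (hk0 _ _)]
      simp only [this]
      rw [integral_mul_const, hq.2, norm_mul, Real.norm_of_nonneg]
      rw [← hq.2]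
      exact integral_nonneg fun p => mul_nonneg (hk0 _ _) (hk0 _ _)
  have hsq : ∀ p, ∫ q, F (p, q) ∂ν.prod ν = (∫ x, k p x * h x ∂ν) ^ 2 := fun p => by
    rw [sq, ← integral_prod_mul]
    refine integral_congr_ae (Eventually.of_forall fun q => ?_)
    simp only [hF]
    ring
  have h1 := hFi.integral_prod_left
  simp only [hsq] at h1
  refine ⟨h1, ?_⟩
  rw [← integral_congr_ae (Eventually.of_forall hsq), ← integral_prod _ hFi,
    integral_prod_symm _ hFi]
  refine integral_congr_ae ?_
  filter_upwards [hK] with q hq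
  simp only [hF]
  rw [integral_mul_const, hq.2]

end FactoredKernel

/-! ### Exponential factorization of the Riesz kernel -/

/-- One-sided exponentials, whose superposition is the Riesz kernel. -/
noncomputable def expFactor (s : ℝ) (p : ℝ × ℝ) (x : ℝ) : ℝ :=
  (Ioi p.2).indicator (fun x => p.1 ^ (s / 2) * Real.exp (-(p.1 * (x - p.2)))) x

theorem expFactor_eq (s : ℝ) (p : ℝ × ℝ) (x : ℝ) : expFactor s p x =
    {q : (ℝ × ℝ) × ℝ | q.1.2 < q.2}.indicator
      (fun q => q.1.1 ^ (s / 2) * Real.exp (-(q.1.1 * (q.2 - q.1.2)))) (p, x) := by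
  simp only [expFactor, indicator, mem_Ioi, mem_ofPred_eq]

theorem measurable_expFactor (s : ℝ) : Measurable (Function.uncurry (expFactor s)) := by
  have : Function.uncurry (expFactor s) = {q : (ℝ × ℝ) × ℝ | q.1.2 < q.2}.indicator
      (fun q => q.1.1 ^ (s / 2) * Real.exp (-(q.1.1 * (q.2 - q.1.2)))) := by
    funext q
    exact expFactor_eq s q.1 q.2
  rw [this]
  refine Measurable.indicator (by fun_prop) (measurableSet_lt (by fun_prop) (by fun_prop))

theorem expFactor_nonneg {s : ℝ} {p : ℝ × ℝ} (hp : 0 ≤ p.1) (x : ℝ) : 0 ≤ expFactor s p x :=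
  indicator_nonneg (fun _ _ => by positivity) _

theorem expFactor_mul {s l : ℝ} (hl : 0 < l) (x y z : ℝ) :
    expFactor s (l, z) x * expFactor s (l, z) y =
      (Iio (min x y)).indicator
        (fun z => l ^ s * Real.exp (-(l * (x + y))) * Real.exp (2 * l * z)) z := by
  unfold expFactor
  by_cases h : z < min x y
  · have h' := lt_min_iff.1 h
    rw [indicator_of_mem (show x ∈ Ioi z from h'.1), indicator_of_mem (show y ∈ Ioi z from h'.2),
      indicator_of_mem (show z ∈ Iio (min x y) from h)]
    have e1 : l ^ s = l ^ (s / 2) * l ^ (s / 2) := by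
      rw [← Real.rpow_add hl]
      ring_nf
    have e2 : Real.exp (-(l * (x - z))) * Real.exp (-(l * (y - z))) =
        Real.exp (-(l * (x + y))) * Real.exp (2 * l * z) := by
      rw [← Real.exp_add, ← Real.exp_add]
      ring_nf
    rw [e1]
    linear_combination l ^ (s / 2) * l ^ (s / 2) * e2
  · rw [indicator_of_notMem (show z ∉ Iio (min x y) from h)]
    rcases not_and_or.1 (mt lt_min_iff.2 h) with h' | h'
    · rw [indicator_of_notMem (show x ∉ Ioi z from h'), zero_mul]
    · rw [indicator_of_notMem (show y ∉ Ioi z from h'), mul_zero]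

theorem integrable_expFactor_mul {s l : ℝ} (hl : 0 < l) (x y : ℝ) :
    Integrable fun z => expFactor s (l, z) x * expFactor s (l, z) y := by
  simp only [expFactor_mul hl]
  rw [integrable_indicator_iff measurableSet_Iio]
  exact ((integrableOn_exp_mul_Iic (by positivity) _).mono_set Iio_subset_Iic_self).const_mul _

/-- Both factors live on `z < min x y`, where `exp (2 * l * z)` integrates to `exp (2 * l * min x y)
/ (2 * l)`; then `x + y - 2 * min x y = |x - y|`. -/
theorem integral_expFactor_mul {s l : ℝ} (hl : 0 < l) (x y : ℝ) :
    ∫ z, expFactor s (l, z) x * expFactor s (l, z) y =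
      1 / 2 * (l ^ (s - 1) * Real.exp (-(|x - y| * l))) := by
  simp only [expFactor_mul hl]
  rw [integral_indicator measurableSet_Iio, integral_const_mul, ← integral_Iic_eq_integral_Iio,
    integral_exp_mul_Iic (by positivity), Real.rpow_sub_one hl.ne']
  have e : Real.exp (-(|x - y| * l)) = Real.exp (-(l * (x + y))) * Real.exp (2 * l * min x y) := by
    rw [← Real.exp_add]
    congr 1
    rcases le_total x y with h | h
    · rw [min_eq_left h, abs_of_nonpos (by linarith)]
      ring
    · rw [min_eq_right h, abs_of_nonneg (by linarith)]
      ring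
  rw [e]
  field_simp

theorem integral_expFactor_mul_prod {s : ℝ} (hs : 0 < s) {x y : ℝ} (hxy : x ≠ y) :
    Integrable (fun p => expFactor s p x * expFactor s p y)
        ((volume.restrict (Ioi (0 : ℝ))).prod volume) ∧
      ∫ p, expFactor s p x * expFactor s p y ∂(volume.restrict (Ioi (0 : ℝ))).prod volume
        = Real.Gamma s / 2 * |x - y| ^ (-s) := by
  have hr : 0 < |x - y| := abs_pos.2 (sub_ne_zero.2 hxy)
  have hval := Real.integral_rpow_mul_exp_neg_mul_Ioi hs hr
  -- A non-integrable function has integral `0` by convention, so the nonzero value `hval` forces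
  -- integrability.
  have hlap : IntegrableOn (fun l : ℝ => l ^ (s - 1) * Real.exp (-(|x - y| * l))) (Ioi 0) := by
    refine Integrable.of_integral_ne_zero ?_
    rw [hval]
    exact (mul_pos (Real.rpow_pos_of_pos (by positivity) _) (Real.Gamma_pos_of_pos hs)).ne'
  have hm (x : ℝ) : Measurable fun p => expFactor s p x :=
    (measurable_expFactor s).comp (measurable_id.prodMk measurable_const)
  have hint : Integrable (fun p => expFactor s p x * expFactor s p y)
      ((volume.restrict (Ioi (0 : ℝ))).prod volume) := by
    have hm2 : Measurable fun p => expFactor s p x * expFactor s p y := (hm x).mul (hm y)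
    rw [integrable_prod_iff hm2.aestronglyMeasurable]
    refine ⟨?_, ?_⟩
    · filter_upwards [ae_restrict_mem measurableSet_Ioi] with l hl
      exact integrable_expFactor_mul hl x y
    · refine (hlap.const_mul (1 / 2)).congr ?_
      filter_upwards [ae_restrict_mem measurableSet_Ioi] with l hl
      have hl0 : (0 : ℝ) < l := hl
      simp only [norm_mul, Real.norm_of_nonneg (expFactor_nonneg (p := (l, _)) hl0.le _)]
      rw [integral_expFactor_mul hl0]
  refine ⟨hint, ?_⟩
  rw [integral_prod _ hint, setIntegral_congr_fun measurableSet_Ioi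
    fun l hl => integral_expFactor_mul hl x y, integral_const_mul, hval, one_div |x - y|,
    Real.inv_rpow hr.le, Real.rpow_neg hr.le]
  ring

/-! ### Positive definiteness on an interval -/

/-- The primitive is continuous and a.e. constant, hence constant; by Lebesgue differentiation its
derivative is `h` a.e. -/
theorem ae_eq_zero_of_integral_Ioi_eq_zero {h : ℝ → ℝ} (hh : Integrable h)
    (h0 : ∀ᵐ z, ∫ x in Ioi z, h x = 0) : h =ᵐ[volume] 0 := by
  have hcont : Continuous fun z => ∫ x in (0 : ℝ)..z, h x :=
    intervalIntegral.continuous_primitive (fun _ _ => hh.intervalIntegrable) 0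
  have hconst : (fun z => ∫ x in (0 : ℝ)..z, h x) = fun _ => ∫ x in Ioi 0, h x := by
    refine (hcont.ae_eq_iff_eq volume continuous_const).1 ?_
    filter_upwards [h0] with z hz
    rw [← intervalIntegral.integral_Ioi_sub_Ioi' hh.integrableOn hh.integrableOn, hz, sub_zero]
  filter_upwards [LocallyIntegrable.ae_hasDerivAt_integral hh.locallyIntegrable] with x hx
  have h1 := hx 0
  rw [hconst] at h1
  exact h1.unique (hasDerivAt_const _ _)

/-- The quadratic form of the Riesz kernel is positive definite. -/
theorem riesz_quadratic_pos {α : ℝ} (hα1 : α < 1) {a b : ℝ}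
    {h : ℝ → ℝ} (hh : Integrable h (volume.restrict (Ioo a b)))
    (hint : Integrable (fun q : ℝ × ℝ => |q.1 - q.2| ^ (α - 1) * (h q.2 * h q.1))
      ((volume.restrict (Ioo a b)).prod (volume.restrict (Ioo a b)))) :
    0 ≤ ∫ q : ℝ × ℝ, |q.1 - q.2| ^ (α - 1) * (h q.2 * h q.1)
        ∂(volume.restrict (Ioo a b)).prod (volume.restrict (Ioo a b)) ∧
      (∫ q : ℝ × ℝ, |q.1 - q.2| ^ (α - 1) * (h q.2 * h q.1)
        ∂(volume.restrict (Ioo a b)).prod (volume.restrict (Ioo a b)) = 0 →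
        h =ᵐ[volume.restrict (Ioo a b)] 0) := by
  have hs : 0 < 1 - α := by linarith
  have hG : 0 < Real.Gamma (1 - α) / 2 := by
    have := Real.Gamma_pos_of_pos hs
    positivity
  set ν := volume.restrict (Ioo a b) with hν
  have hdiag : ∀ᵐ q ∂ν.prod ν, q.1 ≠ q.2 := by
    refine (Measure.ae_prod_iff_ae_ae ?_).2 (Eventually.of_forall fun x => ?_)
    · exact (measurableSet_eq_fun measurable_fst measurable_snd).compl
    · filter_upwards [(measure_eq_zero_iff_ae_notMem.1 (measure_singleton (μ := ν) x))] with y hy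
      exact fun hxy => hy hxy.symm
  set μ := ((volume.restrict (Ioi (0 : ℝ))).prod (volume : Measure ℝ))
  have hμ : ∀ᵐ p ∂μ, 0 < p.1 :=
    Measure.quasiMeasurePreserving_fst.ae (ae_restrict_mem measurableSet_Ioi)
  -- The truncation `max p.1 0` makes the factor nonnegative for every `p`, as the lemma demands,
  -- and changes nothing `μ`-a.e.
  obtain ⟨h1, h2⟩ := integral_factored_kernel (μ := μ) (ν := ν)
    (k := fun p x => expFactor (1 - α) (max p.1 0, p.2) x)
    (K := fun x y => Real.Gamma (1 - α) / 2 * |x - y| ^ (α - 1)) (h := h)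
    ((measurable_expFactor (1 - α)).comp (f := fun q : (ℝ × ℝ) × ℝ => ((max q.1.1 0, q.1.2), q.2))
      (by fun_prop))
    (fun p x => expFactor_nonneg (le_max_right _ _) x)
    (by
      filter_upwards [hdiag] with q hq
      have hc : (fun p => expFactor (1 - α) p q.1 * expFactor (1 - α) p q.2) =ᵐ[μ]
          fun p : ℝ × ℝ => expFactor (1 - α) (max p.1 0, p.2) q.1 *
            expFactor (1 - α) (max p.1 0, p.2) q.2 := by
        filter_upwards [hμ] with p hp
        rw [max_eq_left hp.le]
      have := integral_expFactor_mul_prod hs hq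
      refine ⟨this.1.congr hc, ?_⟩
      rw [← integral_congr_ae hc, this.2, neg_sub])
    hh.aestronglyMeasurable
    ((hint.const_mul (Real.Gamma (1 - α) / 2)).congr
      (Eventually.of_forall fun q => (mul_assoc _ _ _).symm))
  simp only [mul_assoc] at h2
  rw [integral_const_mul] at h2
  have h3 : 0 ≤ ∫ p, (∫ x, expFactor (1 - α) (max p.1 0, p.2) x * h x ∂ν) ^ 2 ∂μ :=
    integral_nonneg fun _ => sq_nonneg _
  refine ⟨nonneg_of_mul_nonneg_right (h2 ▸ h3) hG, fun h0 => ?_⟩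
  rw [h0, mul_zero, eq_comm, integral_eq_zero_iff_of_nonneg (fun _ => sq_nonneg _) h1] at h2
  have h4 := Measure.ae_ae_of_ae_prod h2
  have hne : (ae (volume.restrict (Ioi (0 : ℝ)))).NeBot := by
    rw [ae_neBot, Ne, Measure.restrict_eq_zero, Real.volume_Ioi]
    exact ENNReal.top_ne_zero
  -- A single frequency `l > 0` at which the squares vanish for a.e. `z` is enough to recover `h`.
  obtain ⟨l, hl, hl0⟩ := (h4.and (ae_restrict_mem measurableSet_Ioi)).exists
  have hl0' : (0 : ℝ) < l := hl0
  have hei : Integrable (fun x => Real.exp (-(l * x)) * h x) ν := by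
    refine hh.bdd_mul (c := Real.exp (-(l * a)))
      (Measurable.aestronglyMeasurable (by fun_prop)) ?_
    filter_upwards [ae_restrict_mem measurableSet_Ioo] with x hx
    rw [Real.norm_of_nonneg (Real.exp_pos _).le]
    exact Real.exp_le_exp.2 (by nlinarith [hx.1])
  set e : ℝ → ℝ := (Ioo a b).indicator fun x => Real.exp (-(l * x)) * h x with he
  have he0 : e =ᵐ[volume] 0 := by
    refine ae_eq_zero_of_integral_Ioi_eq_zero
      ((integrable_indicator_iff measurableSet_Ioo).2 hei) ?_
    filter_upwards [hl] with z hz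
    have hz' : ∫ x, expFactor (1 - α) (l, z) x * h x ∂ν = 0 := by
      simpa [max_eq_left hl0'.le] using hz
    -- Up to a positive factor independent of `x`, the vanishing integral is the tail of `e` beyond
    -- `z`.
    have hk : ∀ x, expFactor (1 - α) (l, z) x * h x = l ^ ((1 - α) / 2) * Real.exp (l * z) *
        (Ioi z).indicator (fun x => Real.exp (-(l * x)) * h x) x := fun x => by
      unfold expFactor
      by_cases hx : x ∈ Ioi z
      · rw [indicator_of_mem hx, indicator_of_mem hx]
        have : Real.exp (-(l * (x - z))) = Real.exp (l * z) * Real.exp (-(l * x)) := by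
          rw [← Real.exp_add]
          ring_nf
        simp only [this]
        ring
      · rw [indicator_of_notMem hx, indicator_of_notMem hx]
        ring
    simp only [hk] at hz'
    rw [integral_const_mul] at hz'
    have hpos : 0 < l ^ ((1 - α) / 2) * Real.exp (l * z) := by positivity
    have := (mul_eq_zero.1 hz').resolve_left hpos.ne'
    rw [integral_indicator measurableSet_Ioi, hν, Measure.restrict_restrict measurableSet_Ioi]
      at this
    rw [he, setIntegral_indicator measurableSet_Ioo, this]
  rw [hν]
  filter_upwards [ae_restrict_of_ae he0, ae_restrict_mem measurableSet_Ioo] with x hx hxI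
  rw [he, indicator_of_mem hxI] at hx
  exact (mul_eq_zero.1 hx).resolve_left (Real.exp_pos _).ne'

theorem intervalIntegrable_abs_rpow {r : ℝ} (hr : -1 < r) (a b : ℝ) :
    IntervalIntegrable (fun x : ℝ => |x| ^ r) volume a b := by
  refine intervalIntegrable_of_even (fun x => by rw [abs_neg]) (fun c hc => ?_)
  refine (intervalIntegral.intervalIntegrable_rpow' hr).congr fun x hx => ?_
  rw [uIoc_of_le hc.le] at hx
  simp only [abs_of_pos hx.1]

theorem integrable_abs_sub_rpow {α a b : ℝ} (hα0 : 0 < α) {t : ℝ} (ht : t ∈ Ioo a b) :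
    Integrable (fun w => |t - w| ^ (α - 1)) (volume.restrict (Ioo a b)) := by
  have h := (intervalIntegrable_abs_rpow (r := α - 1) (by linarith) (t - a) (t - b)).comp_sub_left t
  simp only [sub_sub_cancel] at h
  exact ((intervalIntegrable_iff_integrableOn_Ioc_of_le (ht.1.trans ht.2).le).1 h).mono_set
    Ioo_subset_Ioc_self

/-- The range `(t - b, t - a)` of `t - w` lies in `(a - b, b - a)`; the point is that the bound is
uniform in `t`. -/
theorem integral_abs_sub_rpow_le {α a b : ℝ} (hα0 : 0 < α) {t : ℝ} (ht : t ∈ Ioo a b) :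
    ∫ w, |t - w| ^ (α - 1) ∂volume.restrict (Ioo a b) ≤ ∫ r in (a - b)..(b - a), |r| ^ (α - 1) := by
  rw [← integral_Ioc_eq_integral_Ioo,
    ← intervalIntegral.integral_of_le (ht.1.trans ht.2).le,
    intervalIntegral.integral_comp_sub_left (fun r => |r| ^ (α - 1))]
  refine intervalIntegral.integral_mono_interval (by linarith [ht.1]) (by linarith [ht.1, ht.2])
    (by linarith [ht.2]) (Eventually.of_forall fun r => ?_)
    (intervalIntegrable_abs_rpow (by linarith) _ _)
  exact Real.rpow_nonneg (abs_nonneg _) _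

/-! ### The Riesz form in one coordinate, with the others as parameters -/

section Form

variable {Y : Type*} [MeasurableSpace Y] {η : Measure Y} {α a b : ℝ}

theorem integrable_kernel_mul {V : ℝ × Y → ℝ} (hα0 : 0 < α)
    (hV : Integrable V ((volume.restrict (Ioo a b)).prod η)) :
    Integrable (fun q : (ℝ × Y) × ℝ => |q.1.1 - q.2| ^ (α - 1) * V q.1)
      (((volume.restrict (Ioo a b)).prod η).prod (volume.restrict (Ioo a b))) := by
  have hmem : ∀ᵐ p ∂(volume.restrict (Ioo a b)).prod η, p.1 ∈ Ioo a b :=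
    Measure.quasiMeasurePreserving_fst.ae (ae_restrict_mem measurableSet_Ioo)
  have hm : AEStronglyMeasurable (fun q : (ℝ × Y) × ℝ => |q.1.1 - q.2| ^ (α - 1) * V q.1)
      (((volume.restrict (Ioo a b)).prod η).prod (volume.restrict (Ioo a b))) :=
    (Measurable.aestronglyMeasurable (by fun_prop)).mul hV.aestronglyMeasurable.comp_fst
  rw [integrable_prod_iff hm]
  constructor
  · filter_upwards [hmem] with p hp
    exact (integrable_abs_sub_rpow hα0 hp).mul_const _
  · refine (hV.norm.const_mul (∫ r in (a - b)..(b - a), |r| ^ (α - 1))).mono'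
      hm.norm.integral_prod_right' ?_
    filter_upwards [hmem] with p hp
    simp only [norm_mul, Real.norm_of_nonneg (Real.rpow_nonneg (abs_nonneg _) _)]
    rw [integral_mul_const, norm_mul, norm_norm, Real.norm_of_nonneg]
    · exact mul_le_mul_of_nonneg_right (integral_abs_sub_rpow_le hα0 hp) (norm_nonneg _)
    · exact integral_nonneg fun _ => Real.rpow_nonneg (abs_nonneg _) _

variable [SFinite η]

/-- Exchanging the two coordinates in the direction of the fractional integral. -/
theorem measurePreserving_exchange (ν : Measure ℝ) [SFinite ν] :
    MeasurePreserving (fun q : (ℝ × Y) × ℝ => ((q.2, q.1.2), q.1.1))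
      ((ν.prod η).prod ν) ((ν.prod η).prod ν) := by
  have h1 : MeasurePreserving (fun q : (ℝ × Y) × ℝ => (q.2, (q.1.2, q.1.1)))
      ((ν.prod η).prod ν) (ν.prod (η.prod ν)) :=
    ((MeasurePreserving.id ν).prod Measure.measurePreserving_swap).comp
      Measure.measurePreserving_swap
  exact (measurePreserving_prodAssoc ν η ν).symm.comp h1

/-- Brings the parameter `y` to the outside, so that the form can be studied slice by slice. -/
theorem measurePreserving_slice (ν : Measure ℝ) [SFinite ν] :
    MeasurePreserving (fun z : Y × (ℝ × ℝ) => ((z.2.1, z.1), z.2.2))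
      (η.prod (ν.prod ν)) ((ν.prod η).prod ν) :=
  ((Measure.measurePreserving_swap (μ := η) (ν := ν)).prod (MeasurePreserving.id ν)).comp
    (measurePreserving_prodAssoc η ν ν).symm

/-- Since `|H * V| ≤ H ^ 2 + V ^ 2`, `integrable_kernel_mul` suffices, for `H` after exchanging the
two coordinates. -/
theorem integrable_rieszForm {H V : ℝ × Y → ℝ} (hα0 : 0 < α)
    (hH : MemLp H 2 ((volume.restrict (Ioo a b)).prod η))
    (hV : MemLp V 2 ((volume.restrict (Ioo a b)).prod η)) :
    Integrable (fun q : (ℝ × Y) × ℝ => |q.1.1 - q.2| ^ (α - 1) * (H (q.2, q.1.2) * V q.1))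
      (((volume.restrict (Ioo a b)).prod η).prod (volume.restrict (Ioo a b))) := by
  have hx := measurePreserving_exchange (η := η) (volume.restrict (Ioo a b))
  have h1 := integrable_kernel_mul hα0 hV.integrable_sq
  have h2 := (hx.integrable_comp_of_integrable (integrable_kernel_mul hα0 hH.integrable_sq))
  have hHm : AEStronglyMeasurable (fun q : (ℝ × Y) × ℝ => H (q.2, q.1.2))
      (((volume.restrict (Ioo a b)).prod η).prod (volume.restrict (Ioo a b))) :=
    (hH.aestronglyMeasurable.comp_fst).comp_measurePreserving hx
  refine (h1.add h2).mono' ((Measurable.aestronglyMeasurable (by fun_prop)).mul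
    (hHm.mul hV.aestronglyMeasurable.comp_fst)) (Eventually.of_forall fun q => ?_)
  simp only [Pi.add_apply, Function.comp_apply, norm_mul,
    Real.norm_of_nonneg (Real.rpow_nonneg (abs_nonneg (q.1.1 - q.2)) (α - 1)), Real.norm_eq_abs]
  rw [abs_sub_comm q.2, ← mul_add]
  refine mul_le_mul_of_nonneg_left ?_ (Real.rpow_nonneg (abs_nonneg _) _)
  rw [← sq_abs (V q.1), ← sq_abs (H _)]
  nlinarith [sq_nonneg (|V q.1| - |H (q.2, q.1.2)|), sq_nonneg (|V q.1|),
    sq_nonneg (|H (q.2, q.1.2)|)]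

/-- The bilinear form of the Riesz kernel acting on the first coordinate. -/
noncomputable def rieszForm (α a b : ℝ) (η : Measure Y) (H V : ℝ × Y → ℝ) : ℝ :=
  ∫ q : (ℝ × Y) × ℝ, |q.1.1 - q.2| ^ (α - 1) * (H (q.2, q.1.2) * V q.1)
    ∂((volume.restrict (Ioo a b)).prod η).prod (volume.restrict (Ioo a b))

theorem rieszForm_sub_left {H₁ H₂ V : ℝ × Y → ℝ} (hα0 : 0 < α)
    (hH₁ : MemLp H₁ 2 ((volume.restrict (Ioo a b)).prod η))
    (hH₂ : MemLp H₂ 2 ((volume.restrict (Ioo a b)).prod η))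
    (hV : MemLp V 2 ((volume.restrict (Ioo a b)).prod η)) :
    rieszForm α a b η (H₁ - H₂) V = rieszForm α a b η H₁ V - rieszForm α a b η H₂ V := by
  unfold rieszForm
  rw [← integral_sub (integrable_rieszForm hα0 hH₁ hV) (integrable_rieszForm hα0 hH₂ hV)]
  refine integral_congr_ae (Eventually.of_forall fun q => ?_)
  simp only [Pi.sub_apply]
  ring

/-- By Fubini the form is the integral over `y` of the one-dimensional forms of the slices, which
are a.e. in `L²` of a bounded interval, hence integrable. -/
theorem rieszForm_pos {H : ℝ × Y → ℝ} (hα0 : 0 < α) (hα1 : α < 1)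
    (hH : MemLp H 2 ((volume.restrict (Ioo a b)).prod η)) :
    0 ≤ rieszForm α a b η H H ∧
      (rieszForm α a b η H H = 0 → H =ᵐ[(volume.restrict (Ioo a b)).prod η] 0) := by
  set ν := volume.restrict (Ioo a b) with hν
  have hs := measurePreserving_slice (η := η) ν
  have hi := integrable_rieszForm hα0 hH hH
  have hHs : AEStronglyMeasurable (fun p : Y × ℝ => H p.swap) (η.prod ν) :=
    hH.aestronglyMeasurable.prod_swap
  have hi' : Integrable (fun z : Y × (ℝ × ℝ) =>
      |z.2.1 - z.2.2| ^ (α - 1) * (H (z.2.2, z.1) * H (z.2.1, z.1))) (η.prod (ν.prod ν)) :=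
    hs.integrable_comp_of_integrable hi
  have hval : rieszForm α a b η H H = ∫ y, ∫ q : ℝ × ℝ,
      |q.1 - q.2| ^ (α - 1) * (H (q.2, y) * H (q.1, y)) ∂ν.prod ν ∂η := by
    rw [← integral_prod _ hi', rieszForm, ← hs.map_eq, integral_map hs.measurable.aemeasurable
      (hs.map_eq.symm ▸ hi.aestronglyMeasurable)]
  have hH1 : ∀ᵐ y ∂η, Integrable (fun t => H (t, y)) ν := by
    have hsq : ∀ᵐ y ∂η, Integrable (fun t => H (t, y) ^ 2) ν := hH.integrable_sq.prod_left_ae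
    have hsm : ∀ᵐ y ∂η, AEStronglyMeasurable (fun t => H (t, y)) ν := hHs.prodMk_left
    filter_upwards [hsq, hsm] with y h1 h2
    exact ((memLp_two_iff_integrable_sq h2).2 h1).integrable one_le_two
  have key : ∀ᵐ y ∂η, 0 ≤ ∫ q : ℝ × ℝ, |q.1 - q.2| ^ (α - 1) * (H (q.2, y) * H (q.1, y))
        ∂ν.prod ν ∧ (∫ q : ℝ × ℝ, |q.1 - q.2| ^ (α - 1) * (H (q.2, y) * H (q.1, y))
        ∂ν.prod ν = 0 → (fun t => H (t, y)) =ᵐ[ν] 0) := by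
    filter_upwards [hH1, hi'.prod_right_ae] with y h1 h2
    exact riesz_quadratic_pos hα1 h1 h2
  have hnn := key.mono fun y hy => hy.1
  refine ⟨hval ▸ integral_nonneg_of_ae hnn, fun h0 => ?_⟩
  rw [hval, integral_eq_zero_iff_of_nonneg_ae hnn hi'.integral_prod_left] at h0
  have h1 : ∀ᵐ y ∂η, ∀ᵐ t ∂ν, H (t, y) = 0 := by
    filter_upwards [h0, key] with y h2 h3
    exact h3.2 h2
  have hsw : (fun p : Y × ℝ => H p.swap) =ᵐ[η.prod ν] 0 := by
    -- `Measure.ae_prod_iff_ae_ae` needs a measurable set, hence the passage to a measurable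
    -- representative.
    have hmk := hHs.ae_eq_mk
    have : ∀ᵐ p ∂η.prod ν, hHs.mk _ p = 0 := by
      rw [Measure.ae_prod_iff_ae_ae (measurableSet_eq_fun hHs.stronglyMeasurable_mk.measurable
        measurable_const)]
      filter_upwards [h1, Measure.ae_ae_of_ae_prod hmk] with y h2 h3
      filter_upwards [h2, h3] with t h4 h5
      exact h5.symm.trans h4
    filter_upwards [hmk, this] with p h2 h3
    exact h2.trans h3
  exact (Measure.measurePreserving_swap (μ := ν) (ν := η)).quasiMeasurePreserving.ae hsw

/-- With the domain fixed as `Ioo a b`, the left and right integrals differ only in complementary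
cut-offs at `t`. -/
theorem leftRL_eq {h : ℝ → ℝ} {t : ℝ} (ht : t ∈ Ioo a b) : leftRL α a h t =
    1 / Real.Gamma α * ∫ w in Ioo a b, (Iic t).indicator (fun w => |t - w| ^ (α - 1) * h w) w := by
  have : Ioo a b ∩ Iic t = Ioc a t := by
    ext w
    simp only [mem_inter_iff, mem_Ioo, mem_Iic, mem_Ioc]
    exact ⟨fun h => ⟨h.1.1, h.2⟩, fun h => ⟨⟨h.1, h.2.trans_lt ht.2⟩, h.2⟩⟩
  rw [leftRL, setIntegral_indicator measurableSet_Iic, this,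
    intervalIntegral.integral_of_le ht.1.le]
  congr 1
  refine setIntegral_congr_fun measurableSet_Ioc fun w hw => ?_
  simp only [abs_of_nonneg (sub_nonneg.2 hw.2)]

theorem rightRL_eq {h : ℝ → ℝ} {t : ℝ} (ht : t ∈ Ioo a b) : rightRL α b h t =
    1 / Real.Gamma α *
      ∫ w in Ioo a b, (Iic t)ᶜ.indicator (fun w => |t - w| ^ (α - 1) * h w) w := by
  have : Ioo a b ∩ (Iic t)ᶜ = Ioo t b := by
    ext w
    simp only [mem_inter_iff, mem_Ioo, mem_Iic, mem_compl_iff, not_le]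
    exact ⟨fun h => ⟨h.2, h.1.2⟩, fun h => ⟨⟨ht.1.trans h.1, h.2⟩, h.1⟩⟩
  rw [rightRL, setIntegral_indicator measurableSet_Iic.compl, this,
    intervalIntegral.integral_of_le ht.2.le, integral_Ioc_eq_integral_Ioo]
  congr 1
  refine setIntegral_congr_fun measurableSet_Ioo fun w hw => ?_
  simp only [abs_of_neg (sub_neg.2 hw.1), neg_sub]

/-- The regions `w ≤ t` and `w > t` tile the square, and both one-sided kernels are `|t - w| ^ (α -
1)` there. -/
theorem integral_RL_add {H V : ℝ × Y → ℝ} (hα0 : 0 < α)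
    (hH : MemLp H 2 ((volume.restrict (Ioo a b)).prod η))
    (hV : MemLp V 2 ((volume.restrict (Ioo a b)).prod η)) :
    ∫ p, leftRL α a (fun w => H (w, p.2)) p.1 * V p ∂(volume.restrict (Ioo a b)).prod η
      + ∫ p, rightRL α b (fun w => H (w, p.2)) p.1 * V p ∂(volume.restrict (Ioo a b)).prod η
      = 1 / Real.Gamma α * rieszForm α a b η H V := by
  have hi := integrable_rieszForm hα0 hH hV
  set ν := volume.restrict (Ioo a b) with hν
  have hmem : ∀ᵐ p ∂ν.prod η, p.1 ∈ Ioo a b :=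
    Measure.quasiMeasurePreserving_fst.ae (ae_restrict_mem measurableSet_Ioo)
  set S : Set ((ℝ × Y) × ℝ) := {q | q.2 ≤ q.1.1} with hS
  have hSm : MeasurableSet S := measurableSet_le (by fun_prop) (by fun_prop)
  set F : (ℝ × Y) × ℝ → ℝ := fun q => |q.1.1 - q.2| ^ (α - 1) * (H (q.2, q.1.2) * V q.1) with hF
  have hsec (p : ℝ × Y) (w : ℝ) : S.indicator F (p, w) =
      (Iic p.1).indicator (fun w => |p.1 - w| ^ (α - 1) * H (w, p.2)) w * V p := by
    by_cases hw : w ≤ p.1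
    · rw [indicator_of_mem (show (p, w) ∈ S from hw), indicator_of_mem (show w ∈ Iic p.1 from hw),
        mul_assoc]
    · rw [indicator_of_notMem (show (p, w) ∉ S from hw),
        indicator_of_notMem (show w ∉ Iic p.1 from hw), zero_mul]
  have hsec' (p : ℝ × Y) (w : ℝ) : Sᶜ.indicator F (p, w) =
      (Iic p.1)ᶜ.indicator (fun w => |p.1 - w| ^ (α - 1) * H (w, p.2)) w * V p := by
    by_cases hw : w ≤ p.1
    · rw [indicator_of_notMem (show (p, w) ∉ Sᶜ from not_not.2 hw),
        indicator_of_notMem (show w ∉ (Iic p.1)ᶜ from not_not.2 hw), zero_mul]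
    · rw [indicator_of_mem (show (p, w) ∈ Sᶜ from hw),
        indicator_of_mem (show w ∈ (Iic p.1)ᶜ from hw), mul_assoc]
  have hl : ∫ p, leftRL α a (fun w => H (w, p.2)) p.1 * V p ∂ν.prod η =
      1 / Real.Gamma α * ∫ q in S, F q ∂(ν.prod η).prod ν := by
    rw [← integral_indicator hSm, integral_prod _ (hi.indicator hSm), ← integral_const_mul]
    refine integral_congr_ae ?_
    filter_upwards [hmem] with p hp
    simp only [hsec]
    rw [leftRL_eq hp, integral_mul_const, mul_assoc]
  have hr : ∫ p, rightRL α b (fun w => H (w, p.2)) p.1 * V p ∂ν.prod η =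
      1 / Real.Gamma α * ∫ q in Sᶜ, F q ∂(ν.prod η).prod ν := by
    rw [← integral_indicator hSm.compl, integral_prod _ (hi.indicator hSm.compl),
      ← integral_const_mul]
    refine integral_congr_ae ?_
    filter_upwards [hmem] with p hp
    simp only [hsec']
    rw [rightRL_eq hp, integral_mul_const, mul_assoc]
  rw [hl, hr, ← mul_add, integral_add_compl hSm hi]
  rfl

end Form

/-! ### Uniqueness and linearity of weak derivatives -/

section WeakPartial

variable {n : ℕ} {a b : Fin n → ℝ} {i : Fin n}

theorem isOpen_box (a b : Fin n → ℝ) : IsOpen (box a b) :=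
  isOpen_set_pi finite_univ fun _ _ => isOpen_Ioo

instance isFiniteMeasure_vol (a b : Fin n → ℝ) : IsFiniteMeasure (vol a b) := by
  refine ⟨?_⟩
  rw [vol, Measure.restrict_apply_univ, box, volume_pi, Measure.pi_pi]
  exact ENNReal.prod_lt_top fun i _ => by simp

theorem continuous_pderiv {φ : (Fin n → ℝ) → ℝ} (hφ : ContDiff ℝ ∞ φ) (i : Fin n) :
    Continuous (pderiv i φ) :=
  (hφ.continuous_fderiv (by simp)).clm_apply continuous_const

theorem pderiv_sub {φ ψ : (Fin n → ℝ) → ℝ} (hφ : ContDiff ℝ ∞ φ) (hψ : ContDiff ℝ ∞ ψ)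
    (i : Fin n) : pderiv i (φ - ψ) = pderiv i φ - pderiv i ψ := by
  funext x
  simp only [pderiv, Pi.sub_apply]
  rw [fderiv_sub (hφ.differentiable (by simp) x) (hψ.differentiable (by simp) x)]
  rfl

theorem integrable_mul_pderiv {u φ : (Fin n → ℝ) → ℝ} (hu : MemLp u 2 (vol a b))
    (hφ : ContDiff ℝ ∞ φ) (hc : HasCompactSupport φ) :
    Integrable (fun x => u x * pderiv i φ x) (vol a b) :=
  hu.integrable_mul (q := 2) (((continuous_pderiv hφ i)).memLp_of_hasCompactSupport
    (hc.fderiv_apply ℝ _))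

theorem integrable_mul_test {u φ : (Fin n → ℝ) → ℝ} (hu : MemLp u 2 (vol a b))
    (hφ : ContDiff ℝ ∞ φ) (hc : HasCompactSupport φ) :
    Integrable (fun x => u x * φ x) (vol a b) :=
  hu.integrable_mul (q := 2) (hφ.continuous.memLp_of_hasCompactSupport hc)

theorem IsWeakPartial.sub {u v d e : (Fin n → ℝ) → ℝ} (hu : MemLp u 2 (vol a b))
    (hv : MemLp v 2 (vol a b)) (hd : IsWeakPartial a b i u d) (he : IsWeakPartial a b i v e) :
    IsWeakPartial a b i (u - v) (d - e) := by
  refine ⟨hd.1.sub he.1, fun φ hφ hc hs => ?_⟩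
  simp only [Pi.sub_apply, sub_mul]
  rw [integral_sub (integrable_mul_pderiv hu hφ hc) (integrable_mul_pderiv hv hφ hc),
    integral_sub (integrable_mul_test hd.1 hφ hc) (integrable_mul_test he.1 hφ hc),
    hd.2 φ hφ hc hs, he.2 φ hφ hc hs]
  ring

theorem IsWeakPartial.congr {u v d : (Fin n → ℝ) → ℝ} (hd : IsWeakPartial a b i u d)
    (huv : u =ᵐ[vol a b] v) : IsWeakPartial a b i v d := by
  refine ⟨hd.1, fun φ hφ hc hs => ?_⟩
  rw [← hd.2 φ hφ hc hs]
  refine integral_congr_ae ?_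
  filter_upwards [huv] with x hx
  rw [hx]

/-- The fundamental lemma of the calculus of variations; it makes the choice in `weakPartial`
harmless. -/
theorem IsWeakPartial.ae_eq {u d e : (Fin n → ℝ) → ℝ} (hd : IsWeakPartial a b i u d)
    (he : IsWeakPartial a b i u e) : d =ᵐ[vol a b] e := by
  have hint : Integrable (d - e) (vol a b) := (hd.1.sub he.1).integrable one_le_two
  have h0 : ∀ᵐ x ∂volume, x ∈ box a b → (d - e) x = 0 := by
    refine IsOpen.ae_eq_zero_of_integral_contDiff_smul_eq_zero (isOpen_box a b)
      (IntegrableOn.locallyIntegrableOn hint) fun φ hφ hc hs => ?_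
    have h1 : ∫ x, φ x • (d - e) x = ∫ x, φ x • (d - e) x ∂(vol a b) := by
      refine (setIntegral_eq_integral_of_forall_compl_eq_zero fun x hx => ?_).symm
      rw [image_eq_zero_of_notMem_tsupport fun h => hx (hs h), zero_smul]
    have h2 : ∀ x, φ x • (d - e) x = d x * φ x - e x * φ x := fun x => by
      simp only [smul_eq_mul, Pi.sub_apply]
      ring
    rw [h1]
    simp only [h2]
    have hφ' : ContDiff ℝ ∞ φ := hφ
    rw [integral_sub (integrable_mul_test hd.1 hφ' hc) (integrable_mul_test he.1 hφ' hc)]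
    linarith [hd.2 φ hφ' hc hs, he.2 φ hφ' hc hs]
  filter_upwards [(ae_restrict_iff' (isOpen_box a b).measurableSet).2 h0] with x hx
  exact sub_eq_zero.1 hx

theorem isWeakPartial_zero : IsWeakPartial a b i 0 0 :=
  ⟨MemLp.zero, fun φ _ _ _ => by simp⟩

theorem isWeakPartial_weakPartial {u : (Fin n → ℝ) → ℝ} (hu : MemH1 a b u) (i : Fin n) :
    IsWeakPartial a b i u (weakPartial a b i u) := by
  rw [weakPartial, dif_pos (hu.2 i)]
  exact (hu.2 i).choose_spec

theorem memLp_weakPartial {u : (Fin n → ℝ) → ℝ} (hu : MemH1 a b u) (i : Fin n) :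
    MemLp (weakPartial a b i u) 2 (vol a b) :=
  (isWeakPartial_weakPartial hu i).1

theorem MemH1.sub {u v : (Fin n → ℝ) → ℝ} (hu : MemH1 a b u) (hv : MemH1 a b v) :
    MemH1 a b (u - v) :=
  ⟨hu.1.sub hv.1, fun i => ⟨_, (isWeakPartial_weakPartial hu i).sub hu.1 hv.1
    (isWeakPartial_weakPartial hv i)⟩⟩

theorem weakPartial_sub {u v : (Fin n → ℝ) → ℝ} (hu : MemH1 a b u) (hv : MemH1 a b v)
    (i : Fin n) :
    weakPartial a b i (u - v) =ᵐ[vol a b] weakPartial a b i u - weakPartial a b i v :=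
  (isWeakPartial_weakPartial (hu.sub hv) i).ae_eq ((isWeakPartial_weakPartial hu i).sub hu.1 hv.1
    (isWeakPartial_weakPartial hv i))

theorem weakPartial_ae_eq_zero {v : (Fin n → ℝ) → ℝ} (hv : MemH1 a b v) (hv0 : v =ᵐ[vol a b] 0)
    (i : Fin n) : weakPartial a b i v =ᵐ[vol a b] 0 :=
  ((isWeakPartial_weakPartial hv i).congr hv0).ae_eq isWeakPartial_zero

end WeakPartial

/-! ### Traces and the Poincaré inequality -/

section Trace

variable {d : ℕ} {a b : Fin (d + 1) → ℝ}

theorem onFace_sub (i : Fin (d + 1)) (c : ℝ) (φ ψ : (Fin (d + 1) → ℝ) → ℝ) :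
    onFace i c (φ - ψ) = onFace i c φ - onFace i c ψ := rfl

theorem continuous_insertNth (i : Fin (d + 1)) :
    Continuous fun p : ℝ × (Fin d → ℝ) => (i.insertNth p.1 p.2 : Fin (d + 1) → ℝ) :=
  Continuous.finInsertNth (A := fun _ => ℝ) i continuous_fst continuous_snd

theorem continuous_onFace {φ : (Fin (d + 1) → ℝ) → ℝ} (hφ : Continuous φ) (i : Fin (d + 1))
    (c : ℝ) : Continuous (onFace i c φ) :=
  hφ.comp ((continuous_insertNth i).comp (continuous_const.prodMk continuous_id))

theorem tendsto_eLpNorm_sub_sub {X : Type*} [MeasurableSpace X] {μ : Measure X}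
    {p q : ℕ → X → ℝ} {u v : X → ℝ} (hp : ∀ k, AEStronglyMeasurable (p k) μ)
    (hq : ∀ k, AEStronglyMeasurable (q k) μ) (hu : AEStronglyMeasurable u μ)
    (hv : AEStronglyMeasurable v μ)
    (hpu : Tendsto (fun k => eLpNorm (p k - u) 2 μ) atTop (𝓝 0))
    (hqv : Tendsto (fun k => eLpNorm (q k - v) 2 μ) atTop (𝓝 0)) :
    Tendsto (fun k => eLpNorm (p k - q k - (u - v)) 2 μ) atTop (𝓝 0) := by
  have h := hpu.add hqv
  rw [add_zero] at h
  refine tendsto_of_tendsto_of_tendsto_of_le_of_le tendsto_const_nhds h (fun _ => zero_le)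
    fun k => ?_
  dsimp only
  rw [sub_sub_sub_comm]
  exact eLpNorm_sub_le ((hp k).sub hu) ((hq k).sub hv) one_le_two

theorem HasTrace.sub {u v g : (Fin (d + 1) → ℝ) → ℝ} (hu : HasTrace a b u g)
    (hv : HasTrace a b v g) : HasTrace a b (u - v) 0 := by
  obtain ⟨hu1, hg, φ, hφ, hφ0, hφ1, hφ2⟩ := hu
  obtain ⟨hv1, -, ψ, hψ, hψ0, hψ1, hψ2⟩ := hv
  refine ⟨hu1.sub hv1, fun i c _ => MemLp.zero, fun k => φ k - ψ k,
    fun k => (hφ k).sub (hψ k), ?_, fun i => ?_, fun i c hc => ?_⟩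
  · exact tendsto_eLpNorm_sub_sub (fun k => (hφ k).continuous.aestronglyMeasurable)
      (fun k => (hψ k).continuous.aestronglyMeasurable) hu1.1.1 hv1.1.1 hφ0 hψ0
  · refine (tendsto_eLpNorm_sub_sub
      (fun k => (continuous_pderiv (hφ k) i).aestronglyMeasurable)
      (fun k => (continuous_pderiv (hψ k) i).aestronglyMeasurable)
      (memLp_weakPartial hu1 i).1 (memLp_weakPartial hv1 i).1 (hφ1 i) (hψ1 i)).congr fun k => ?_
    rw [pderiv_sub (hφ k) (hψ k)]
    exact eLpNorm_congr_ae (EventuallyEq.rfl.sub (weakPartial_sub hu1 hv1 i).symm)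
  · refine (tendsto_eLpNorm_sub_sub
      (fun k => (continuous_onFace (hφ k).continuous i c).aestronglyMeasurable)
      (fun k => (continuous_onFace (hψ k).continuous i c).aestronglyMeasurable)
      (hg i c hc).1 (hg i c hc).1 (hφ2 i c hc) (hψ2 i c hc)).congr fun k => ?_
    rw [sub_self, onFace_sub]
    rfl

theorem coe_piFinSuccAbove_symm (i : Fin (d + 1)) (p : ℝ × (Fin d → ℝ)) :
    (MeasurableEquiv.piFinSuccAbove (fun _ : Fin (d + 1) => ℝ) i).symm p = i.insertNth p.1 p.2 :=
  rfl

/-- Cartesian coordinates `(xᵢ, remaining coordinates)` on the box. -/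
theorem measurePreserving_insertNth (a b : Fin (d + 1) → ℝ) (i : Fin (d + 1)) :
    MeasurePreserving (MeasurableEquiv.piFinSuccAbove (fun _ : Fin (d + 1) => ℝ) i).symm
      ((volume.restrict (Ioo (a i) (b i))).prod (faceVol a b i)) (vol a b) := by
  have h := ((volume_preserving_piFinSuccAbove (fun _ : Fin (d + 1) => ℝ) i).symm
    _).restrict_preimage (isOpen_box a b).measurableSet
  have hpre : (MeasurableEquiv.piFinSuccAbove (fun _ : Fin (d + 1) => ℝ) i).symm ⁻¹' box a b =
      Ioo (a i) (b i) ×ˢ box (fun j => a (i.succAbove j)) (fun j => b (i.succAbove j)) := by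
    ext p
    change (i.insertNth p.1 p.2 : Fin (d + 1) → ℝ) ∈ box a b ↔ _
    simp only [box, mem_univ_pi, mem_prod]
    rw [Fin.forall_iff_succAbove i]
    simp only [Fin.insertNth_apply_same, Fin.insertNth_apply_succAbove]
  rw [hpre] at h
  rw [faceVol, vol, Measure.prod_restrict]
  exact h

theorem hasDerivAt_insertNth {φ : (Fin (d + 1) → ℝ) → ℝ} (hφ : ContDiff ℝ ∞ φ)
    (i : Fin (d + 1)) (y : Fin d → ℝ) (w : ℝ) :
    HasDerivAt (fun w => φ (i.insertNth w y)) (pderiv i φ (i.insertNth w y)) w := by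
  have h1 : HasDerivAt (fun w : ℝ => (i.insertNth w y : Fin (d + 1) → ℝ)) (Pi.single i 1) w := by
    have h2 := hasDerivAt_update (i.insertNth 0 y : Fin (d + 1) → ℝ) i w
    refine h2.congr_of_eventuallyEq (Eventually.of_forall fun w => ?_)
    simp only [Fin.update_insertNth]
  exact (hφ.differentiable (by simp) _).hasFDerivAt.comp_hasDerivAt w h1

/-- The fundamental theorem of calculus along the `i`-th axis, starting from the face at `l`. -/
theorem enorm_le_face_add_lintegral {φ : (Fin (d + 1) → ℝ) → ℝ} (hφ : ContDiff ℝ ∞ φ)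
    (i : Fin (d + 1)) (y : Fin d → ℝ) {l r t : ℝ} (ht : t ∈ Ioo l r) :
    ‖φ (i.insertNth t y)‖ₑ ≤
      ‖onFace i l φ y‖ₑ + ∫⁻ w in Ioo l r, ‖pderiv i φ (i.insertNth w y)‖ₑ := by
  have hc : Continuous fun w : ℝ => pderiv i φ (i.insertNth w y) :=
    (continuous_pderiv hφ i).comp ((continuous_insertNth i).comp
      (continuous_id.prodMk continuous_const))
  have h1 := intervalIntegral.integral_eq_sub_of_hasDerivAt
    (fun w _ => hasDerivAt_insertNth hφ i y w) (hc.intervalIntegrable l t)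
  have h2 : φ (i.insertNth t y) =
      onFace i l φ y + ∫ w in l..t, pderiv i φ (i.insertNth w y) := by
    rw [h1, onFace]
    ring
  rw [h2]
  refine (enorm_add_le _ _).trans (add_le_add_right ?_ _)
  rw [intervalIntegral.integral_of_le ht.1.le]
  refine (enorm_integral_le_lintegral_enorm _).trans (lintegral_mono_set fun w hw => ?_)
  exact ⟨hw.1, hw.2.trans_lt ht.2⟩

/-- A Poincaré inequality in `L¹` for functions smooth up to the boundary. -/
theorem eLpNorm_one_le_face_add_pderiv {φ : (Fin (d + 1) → ℝ) → ℝ} (hφ : ContDiff ℝ ∞ φ)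
    (a b : Fin (d + 1) → ℝ) (i : Fin (d + 1)) :
    eLpNorm φ 1 (vol a b) ≤ (eLpNorm (onFace i (a i) φ) 1 (faceVol a b i) +
      eLpNorm (pderiv i φ) 1 (vol a b)) * volume (Ioo (a i) (b i)) := by
  have hmp := measurePreserving_insertNth a b i
  have hemb :=
    (MeasurableEquiv.piFinSuccAbove (fun _ : Fin (d + 1) => ℝ) i).symm.measurableEmbedding
  have hfm : IsFiniteMeasure (faceVol a b i) := isFiniteMeasure_vol _ _
  have hcp (ψ : (Fin (d + 1) → ℝ) → ℝ) (hψ : Continuous ψ) :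
      Measurable fun p : ℝ × (Fin d → ℝ) => ‖ψ (i.insertNth p.1 p.2)‖ₑ :=
    (hψ.comp (continuous_insertNth i)).enorm.measurable
  simp only [eLpNorm_one_eq_lintegral_enorm]
  rw [← hmp.lintegral_comp_emb hemb, ← hmp.lintegral_comp_emb hemb]
  change ∫⁻ p : ℝ × (Fin d → ℝ), ‖φ (i.insertNth p.1 p.2)‖ₑ ∂_ ≤ (_ +
    ∫⁻ p : ℝ × (Fin d → ℝ), ‖pderiv i φ (i.insertNth p.1 p.2)‖ₑ ∂_) * _
  -- The length of the side becomes an integral over `t`, so both sides can be compared for each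
  -- fixed `t` and `y`.
  rw [lintegral_prod _ (hcp φ hφ.continuous).aemeasurable,
    lintegral_prod_symm _ (hcp _ (continuous_pderiv hφ i)).aemeasurable,
    ← lintegral_add_left (continuous_onFace hφ.continuous i (a i)).enorm.measurable,
    ← setLIntegral_const]
  refine setLIntegral_mono measurable_const fun t ht => lintegral_mono fun y => ?_
  exact enorm_le_face_add_lintegral hφ i y ht

/-- Along the sequence defining the zero trace, face values and `i`-th derivatives tend to `0`, in
`L¹` too as the measures are finite; the Poincaré inequality passes to the limit. -/
theorem ae_eq_zero_of_weakPartial_ae_eq_zero {v : (Fin (d + 1) → ℝ) → ℝ} (hv : MemH10 a b v)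
    {i : Fin (d + 1)} (h0 : weakPartial a b i v =ᵐ[vol a b] 0) : v =ᵐ[vol a b] 0 := by
  obtain ⟨hv1, -, -, φ, hφ, hφ0, hφ1, hφ2⟩ := hv
  have hfm : IsFiniteMeasure (faceVol a b i) := isFiniteMeasure_vol _ _
  have hmeas : AEStronglyMeasurable v (vol a b) := hv1.1.1
  have to_one {X : Type} [MeasurableSpace X] {μ : Measure X} [IsFiniteMeasure μ] {p : ℕ → X → ℝ}
      (hp : ∀ k, AEStronglyMeasurable (p k) μ)
      (h : Tendsto (fun k => eLpNorm (p k) 2 μ) atTop (𝓝 0)) :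
      Tendsto (fun k => eLpNorm (p k) 1 μ) atTop (𝓝 0) := by
    have h' := ENNReal.Tendsto.mul_const
      (b := μ univ ^ (1 / (1 : ℝ≥0∞).toReal - 1 / (2 : ℝ≥0∞).toReal)) h (Or.inr (ENNReal.rpow_ne_top_of_nonneg (by norm_num) (measure_ne_top _ _)))
    rw [zero_mul] at h'
    exact tendsto_of_tendsto_of_tendsto_of_le_of_le tendsto_const_nhds h' (fun _ => zero_le)
      fun k => eLpNorm_le_eLpNorm_mul_rpow_measure_univ one_le_two (hp k)
  have t0 := to_one (fun k => (hφ k).continuous.aestronglyMeasurable.sub hmeas) hφ0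
  have t1 : Tendsto (fun k => eLpNorm (pderiv i (φ k)) 1 (vol a b)) atTop (𝓝 0) := by
    refine to_one (fun k => (continuous_pderiv (hφ k) i).aestronglyMeasurable)
      ((hφ1 i).congr fun k => eLpNorm_congr_ae ?_)
    filter_upwards [h0] with x hx
    simp [hx]
  have t2 : Tendsto (fun k => eLpNorm (onFace i (a i) (φ k)) 1 (faceVol a b i)) atTop (𝓝 0) := by
    refine to_one (fun k => (continuous_onFace (hφ k).continuous i _).aestronglyMeasurable)
      ((hφ2 i (a i) (by simp)).congr fun k => ?_)
    congr 1
    exact sub_zero _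
  have t3 := t0.add (ENNReal.Tendsto.mul_const (b := volume (Ioo (a i) (b i))) (t2.add t1)
    (Or.inr (by simp)))
  simp only [add_zero, zero_mul] at t3
  have hle : eLpNorm v 1 (vol a b) ≤ 0 := by
    refine ge_of_tendsto' t3 fun k => ?_
    have hvk : v = φ k - (φ k - v) := (sub_sub_cancel _ _).symm
    calc eLpNorm v 1 (vol a b) = eLpNorm (φ k - (φ k - v)) 1 (vol a b) := by rw [← hvk]
      _ ≤ eLpNorm (φ k) 1 (vol a b) + eLpNorm (φ k - v) 1 (vol a b) :=
        eLpNorm_sub_le (hφ k).continuous.aestronglyMeasurable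
          ((hφ k).continuous.aestronglyMeasurable.sub hmeas) le_rfl
      _ ≤ _ := by
        rw [add_comm]
        exact add_le_add_right (eLpNorm_one_le_face_add_pderiv (hφ k) a b i) _
  exact (eLpNorm_eq_zero_iff hmeas one_ne_zero).1 (le_antisymm hle zero_le)

end Trace

/-! ### The weak form, uniqueness and the operator norm -/

section Pairing

variable {d : ℕ} {a b : Fin (d + 1) → ℝ} {α : ℝ}

theorem memLp_comp_insertNth {h : (Fin (d + 1) → ℝ) → ℝ} (hh : MemLp h 2 (vol a b))
    (i : Fin (d + 1)) :
    MemLp (fun p : ℝ × (Fin d → ℝ) => h (i.insertNth p.1 p.2)) 2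
      ((volume.restrict (Ioo (a i) (b i))).prod (faceVol a b i)) :=
  hh.comp_measurePreserving (measurePreserving_insertNth a b i)

/-- The bilinear form of the Riesz kernel acting on the `i`-th coordinate in the box. -/
noncomputable def rieszFormBox (a b : Fin (d + 1) → ℝ) (α : ℝ) (i : Fin (d + 1))
    (h v : (Fin (d + 1) → ℝ) → ℝ) : ℝ :=
  rieszForm α (a i) (b i) (faceVol a b i) (fun p => h (i.insertNth p.1 p.2))
    (fun p => v (i.insertNth p.1 p.2))

theorem integral_RL_add_box (hα0 : 0 < α) {h v : (Fin (d + 1) → ℝ) → ℝ}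
    (hh : MemLp h 2 (vol a b)) (hv : MemLp v 2 (vol a b)) (i : Fin (d + 1)) :
    ∫ x, leftRL α (a i) (alongLine i h x) (x i) * v x ∂(vol a b)
      + ∫ x, rightRL α (b i) (alongLine i h x) (x i) * v x ∂(vol a b)
      = 1 / Real.Gamma α * rieszFormBox a b α i h v := by
  have hfm : IsFiniteMeasure (faceVol a b i) := isFiniteMeasure_vol _ _
  have hmp := measurePreserving_insertNth a b i
  have hemb :=
    (MeasurableEquiv.piFinSuccAbove (fun _ : Fin (d + 1) => ℝ) i).symm.measurableEmbedding
  have key := integral_RL_add hα0 (memLp_comp_insertNth hh i) (memLp_comp_insertNth hv i)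
  rw [rieszFormBox, ← key, ← hmp.integral_comp hemb, ← hmp.integral_comp hemb]
  have hal (p : ℝ × (Fin d → ℝ)) : alongLine i h (i.insertNth p.1 p.2) =
      fun w => h (i.insertNth w p.2) := by
    funext w
    rw [alongLine, Fin.update_insertNth]
  congr 1 <;>
  · refine integral_congr_ae (Eventually.of_forall fun p => ?_)
    simp only [coe_piFinSuccAbove_symm, hal, Fin.insertNth_apply_same]

theorem pairing_eq (hα0 : 0 < α) {f u v : (Fin (d + 1) → ℝ) → ℝ} (hu : MemH1 a b u)
    (hv : MemH1 a b v) : pairing a b α f u v =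
      1 / Real.Gamma α * ∑ i, rieszFormBox a b α i (weakPartial a b i u) (weakPartial a b i v)
        - ∫ x, f x * v x ∂(vol a b) := by
  rw [pairing, ← Finset.sum_add_distrib, Finset.mul_sum]
  congr 1
  exact Finset.sum_congr rfl fun i _ =>
    integral_RL_add_box hα0 (memLp_weakPartial hu i) (memLp_weakPartial hv i) i

/-- Covers the null test functions, which the supremum in `opNorm` leaves out. -/
theorem pairing_eq_zero_of_ae_eq_zero {f u v : (Fin (d + 1) → ℝ) → ℝ} (hv : MemH1 a b v)
    (hv0 : v =ᵐ[vol a b] 0) : pairing a b α f u v = 0 := by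
  have h1 (T : Fin (d + 1) → (Fin (d + 1) → ℝ) → ℝ) (i : Fin (d + 1)) :
      ∫ x, T i x * weakPartial a b i v x ∂(vol a b) = 0 := by
    refine integral_eq_zero_of_ae ?_
    filter_upwards [weakPartial_ae_eq_zero hv hv0 i] with x hx
    simp [hx]
  have h2 : ∫ x, f x * v x ∂(vol a b) = 0 := by
    refine integral_eq_zero_of_ae ?_
    filter_upwards [hv0] with x hx
    simp [hx]
  rw [pairing, h2, ← Finset.sum_add_distrib, sub_zero]
  refine Finset.sum_eq_zero fun i _ => ?_
  rw [h1 fun i x => leftRL α (a i) (alongLine i (weakPartial a b i u) x) (x i),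
    h1 fun i x => rightRL α (b i) (alongLine i (weakPartial a b i u) x) (x i), add_zero]

theorem rieszFormBox_congr_right {h v w : (Fin (d + 1) → ℝ) → ℝ} (hα0 : 0 < α)
    (hh : MemLp h 2 (vol a b)) (hv : MemLp v 2 (vol a b)) (hvw : v =ᵐ[vol a b] w)
    (i : Fin (d + 1)) : rieszFormBox a b α i h v = rieszFormBox a b α i h w := by
  have hw : MemLp w 2 (vol a b) := hv.ae_eq hvw
  have hG : 1 / Real.Gamma α ≠ 0 := (one_div_pos.2 (Real.Gamma_pos_of_pos hα0)).ne'
  refine mul_left_cancel₀ hG ?_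
  rw [← integral_RL_add_box hα0 hh hv, ← integral_RL_add_box hα0 hh hw]
  congr 1 <;>
  · refine integral_congr_ae ?_
    filter_upwards [hvw] with x hx
    rw [hx]

theorem IsWeakSolution.ae_eq (hα0 : 0 < α) (hα1 : α < 1) {f g u w : (Fin (d + 1) → ℝ) → ℝ}
    (hu : IsWeakSolution a b α f g u) (hw : IsWeakSolution a b α f g w) :
    w =ᵐ[vol a b] u := by
  have he : MemH10 a b (w - u) := ⟨hw.1.sub hu.1, hw.2.1.sub hu.2.1⟩
  have h1 := hw.2.2 _ he
  have h2 := hu.2.2 _ he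
  rw [pairing_eq hα0 hw.1 he.1] at h1
  rw [pairing_eq hα0 hu.1 he.1] at h2
  have hG : 0 < 1 / Real.Gamma α := one_div_pos.2 (Real.Gamma_pos_of_pos hα0)
  -- The pointwise difference agrees with `weakPartial a b i (w - u)` only a.e.; in the first slot
  -- of the form it splits exactly.
  set D : Fin (d + 1) → (Fin (d + 1) → ℝ) → ℝ :=
    fun i => weakPartial a b i w - weakPartial a b i u with hD
  have hDm (i) : MemLp (D i) 2 (vol a b) := (memLp_weakPartial hw.1 i).sub (memLp_weakPartial hu.1 i)
  have hfm (i) : IsFiniteMeasure (faceVol a b i) := isFiniteMeasure_vol _ _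
  have hsub (i) : rieszFormBox a b α i (D i) (D i) =
      rieszFormBox a b α i (weakPartial a b i w) (weakPartial a b i (w - u)) -
      rieszFormBox a b α i (weakPartial a b i u) (weakPartial a b i (w - u)) := by
    rw [rieszFormBox_congr_right hα0 (hDm i) (hDm i) (weakPartial_sub hw.1 hu.1 i).symm]
    exact rieszForm_sub_left hα0 (memLp_comp_insertNth (memLp_weakPartial hw.1 i) i)
      (memLp_comp_insertNth (memLp_weakPartial hu.1 i) i)
      (memLp_comp_insertNth (memLp_weakPartial he.1 i) i)
  have hpos (i) := rieszForm_pos hα0 hα1 (memLp_comp_insertNth (hDm i) i)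
  have hsum : ∑ i, rieszFormBox a b α i (D i) (D i) = 0 := by
    simp only [hsub, Finset.sum_sub_distrib]
    refine mul_left_cancel₀ hG.ne' ?_
    linarith
  -- One direction suffices for the Poincaré argument; index `0` exists since the dimension is `d +
  -- 1`.
  have hz := (Finset.sum_eq_zero_iff_of_nonneg fun i _ => (hpos i).1).1 hsum 0 (Finset.mem_univ _)
  have hD0 : D 0 =ᵐ[vol a b] 0 := by
    rw [← (measurePreserving_insertNth a b 0).map_eq]
    exact (MeasurableEquiv.measurableEmbedding _).ae_map_iff.2 ((hpos 0).2 hz)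
  have h0 := ae_eq_zero_of_weakPartial_ae_eq_zero he ((weakPartial_sub hw.1 hu.1 0).trans hD0)
  filter_upwards [h0] with x hx
  exact sub_eq_zero.1 hx

theorem opNorm_eq_zero_iff {f u : (Fin (d + 1) → ℝ) → ℝ} :
    opNorm a b α f u = 0 ↔ ∀ v, MemH10 a b v → pairing a b α f u v = 0 := by
  simp only [opNorm, ENNReal.iSup_eq_zero, ENNReal.div_eq_zero_iff, ENNReal.ofReal_eq_zero,
    abs_nonpos_iff]
  refine forall₂_congr fun v hv => ⟨fun h => ?_, fun h _ => Or.inl h⟩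
  by_cases hv0 : v =ᵐ[vol a b] 0
  · exact pairing_eq_zero_of_ae_eq_zero hv.1 hv0
  -- A quotient in `[0, ∞]` also vanishes when its denominator is `∞`, which `v ∈ L²` excludes.
  · exact (h hv0).resolve_right hv.1.1.2.ne

end Pairing

end FracDirichlet

open FracDirichlet in
/-- On the box `Ω = ∏ i, (a i, b i)` in dimension `d + 1 ≥ 1`, a function `u ∈ H¹(Ω)` with `u = g`
on `∂Ω` is the unique weak solution of the fractional Dirichlet problem (uniqueness being that of
an element of `L²(Ω)`) if and only if `‖𝓛[u]‖_op = 0`. -/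
theorem mainTheorem3 {d : ℕ} (a b : Fin (d + 1) → ℝ) (hab : ∀ i, a i < b i)
    (α : ℝ) (hα0 : 0 < α) (hα1 : α < 1)
    (f g : (Fin (d + 1) → ℝ) → ℝ) (hf : MeasureTheory.MemLp f 2 (vol a b))
    (u : (Fin (d + 1) → ℝ) → ℝ) (hu : MemH1 a b u) (hug : HasTrace a b u g) :
    (IsWeakSolution a b α f g u ∧
        ∀ w, IsWeakSolution a b α f g w → w =ᵐ[vol a b] u) ↔
      opNorm a b α f u = 0 := by
  rw [opNorm_eq_zero_iff]
  refine ⟨fun h => h.1.2.2, fun h => ?_⟩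
  have hs : IsWeakSolution a b α f g u := ⟨hu, hug, h⟩
  exact ⟨hs, fun w hw => hs.ae_eq hα0 hα1 hw⟩
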